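/- Let $(X,Y)$ be a random vector in $\mathbb{R}^2$ with law $P_{X,Y}$ that has a Lebesgue density $p(x,y)$, and let $p(x)$ be the density of $X$; assume that both densities are strictly positive everywhere with differentiable logarithms. Write $s_x(x)=\partial_x\log p(x)$, $s_x(x,y)=\partial_x\log p(x,y)$ and $s_y(x,y)=\partial_y\log p(x,y)$ for the scores. For $v:\mathbb{R}^2\to\mathbb{R}$, $(y,x)\mapsto v(y,x)$, put \[ L(v)=\mathbb{E}\Big[\big(s_x(X)-\partial_y v(Y,X)-s_x(X,Y)-v(Y,X)\,s_y(X,Y)\big)^2\Big]. \] Let $(X_i,Y_i)_{i\ge1}$ be i.i.d. with law $P_{X,Y}$, let $\hat s_x(x)$, $\hat s_x(x,y)$, $\hat s_y(x,y)$ be estimators of the scores (random functions depending on $n$, for instance computed from the first $n$ observations), and put \[ \hat L_n(v)=\frac1n\sum_{i=1}^n\big(\hat s_x(X_i)-\partial_y v(Y_i,X_i)-\hat s_x(X_i,Y_i)-v(Y_i,X_i)\,\hat s_y(X_i,Y_i)\big)^2 . \] Let $k_{\mathcal X},k_{\mathcal Y}$ be positive semidefinite kernels on $\mathbb{R}$ such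 that, for some constant $B$, $k_{\mathcal X}<B$ and the product kernel $k_{\mathcal X}\otimes k_{\mathcal Y}<B$ everywhere, and let $\mathcal{H}_{\mathcal X}$ and $\mathcal{H}_{\mathcal X,\mathcal Y}$ be the reproducing kernel Hilbert spaces of $k_{\mathcal X}$ and $k_{\mathcal X}\otimes k_{\mathcal Y}$. Assume that the marginal score $s_x(\cdot)$ lies in $\mathcal{H}_{\mathcal X}$, that both components $s_x(\cdot,\cdot)$, $s_y(\cdot,\cdot)$ of the joint score lie in $\mathcal{H}_{\mathcal X,\mathcal Y}$, and that $v\in C_b^1(\mathbb{R}^2,\mathbb{R})$, i.e. $v$ is continuously differentiable and bounded with bounded derivative. Assume further that the estimators take values in the respective spaces, with RKHS norms bounded almost surely by a constant that does not depend on $n$, for all large $n$, and that for some $\alpha>0$ each of \[ \|\hat s_x(\cdot)-s_x(\cdot)\|_{\mathcal{H}_{\mathcal X}},\qquad \|\hat s_x(\cdot,\cdot)-s_x(\cdot,\cdot)\|_{\mathcal{H}_{\mathcal X,\mathcal Y}},\qquad \|\hat s_y(\cdot,\cdot)-s_y(\cdot,\cdot)\|_{\mathcal{H}_{\mathcal X,\mathcal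 Y}} \] is $\mathcal{O}_p(n^{-1/\alpha})$ as $n\to\infty$. Then $L(v)$ is finite and \[ \hat L_n(v)-L(v)=\mathcal{O}_p(n^{-1/\beta}),\qquad \beta=\max\{\alpha,2\}. \] Here $U_n=\mathcal{O}_p(r_n)$ means that for every $\varepsilon>0$ there is $M>0$ such that $P(|U_n|>M r_n)\le\varepsilon$ for all sufficiently large $n$. -/

import Mathlib

open MeasureTheory ProbabilityTheory Filter

noncomputable section

namespace CausalVelocity

/-- `μ` has the density `p` with respect to Lebesgue measure, where `p` is strictly positive
everywhere (full support) and `log p` is differentiable. Such a `p` is continuous, hence is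
determined everywhere by `μ`. -/
structure HasPosDiffDensity {E : Type*} [NormedAddCommGroup E] [NormedSpace ℝ E]
    [MeasureSpace E] (μ : Measure E) (p : E → ℝ) : Prop where
  pos : ∀ z, 0 < p z
  differentiable_log : Differentiable ℝ (fun z => Real.log (p z))
  eq_withDensity : μ = (volume : Measure E).withDensity (fun z => ENNReal.ofReal (p z))

/-- The marginal score `s_x(x) = ∂ₓ log p(x)`. -/
def marginalScore (pX : ℝ → ℝ) (x : ℝ) : ℝ :=
  deriv (fun t => Real.log (pX t)) x

/-- The `x`-component of the joint score, `s_x(x, y) = ∂ₓ log p(x, y)`. -/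
def jointScoreX (p : ℝ × ℝ → ℝ) (z : ℝ × ℝ) : ℝ :=
  deriv (fun t => Real.log (p (t, z.2))) z.1

/-- The `y`-component of the joint score, `s_y(x, y) = ∂_y log p(x, y)`. -/
def jointScoreY (p : ℝ × ℝ → ℝ) (z : ℝ × ℝ) : ℝ :=
  deriv (fun t => Real.log (p (z.1, t))) z.2

/-- `v ∈ C_b¹(ℝ², ℝ)`: continuously differentiable, bounded, with bounded derivative. -/
def IsCbOne (v : ℝ × ℝ → ℝ) : Prop :=
  ContDiff ℝ 1 v ∧ (∃ A : ℝ, ∀ w, |v w| ≤ A) ∧ (∃ A : ℝ, ∀ w, ‖fderiv ℝ v w‖ ≤ A)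

/-- The squared residual at the point `z = (x, y)`,
`(a(x) - ∂_y v(y, x) - (b(x, y) + v(y, x) c(x, y)))²`, where `a`, `b`, `c` are the functions used
as marginal score, `x`-component and `y`-component of the joint score.
The velocity `v` takes its arguments in the order `(y, x)`. -/
def sqResidual (v : ℝ × ℝ → ℝ) (a : ℝ → ℝ) (b c : ℝ × ℝ → ℝ) (z : ℝ × ℝ) : ℝ :=
  (a z.1 - deriv (fun t => v (t, z.1)) z.2 - (b z + v (z.2, z.1) * c z)) ^ 2

/-- The goodness of fit `L(v)`: the expectation of the squared residual at the true scores, for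
`(X, Y)` with law `μ`, joint density `p` and marginal density `pX` of `X`. -/
def gof (μ : Measure (ℝ × ℝ)) (p : ℝ × ℝ → ℝ) (pX : ℝ → ℝ) (v : ℝ × ℝ → ℝ) : ℝ :=
  ∫ z, sqResidual v (marginalScore pX) (jointScoreX p) (jointScoreY p) z ∂μ

/-- The empirical goodness of fit of `n` data points `z 0, …, z (n - 1)` with plug-in scores
`a`, `b`, `c`. -/
def empiricalGof (n : ℕ) (z : ℕ → ℝ × ℝ) (v : ℝ × ℝ → ℝ)
    (a : ℝ → ℝ) (b c : ℝ × ℝ → ℝ) : ℝ :=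
  (1 / (n : ℝ)) * ∑ i ∈ Finset.range n, sqResidual v a b c (z i)

/-- `U n = O_p(r n)` as `n → ∞`: for every `ε > 0` there is `M > 0` such that, for all large `n`,
`P(|U n| > M r n) ≤ ε`. (For non-measurable `U n`, `P` is the outer probability.) -/
def IsBigOp {Ω : Type*} [MeasurableSpace Ω] (P : Measure Ω) (U : ℕ → Ω → ℝ) (r : ℕ → ℝ) : Prop :=
  ∀ ε : ℝ, 0 < ε → ∃ M : ℝ, 0 < M ∧
    ∀ᶠ n : ℕ in atTop, P {ω | M * r n < |U n ω|} ≤ ENNReal.ofReal ε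

/-- The random elements `S n` of a normed space have, for large `n`, norms bounded almost surely by
one deterministic constant. -/
def IsNormBounded {Ω H : Type*} [MeasurableSpace Ω] [NormedAddCommGroup H]
    (P : Measure Ω) (S : ℕ → Ω → H) : Prop :=
  ∃ M : ℝ, ∀ᶠ n : ℕ in atTop, ∀ᵐ ω ∂P, ‖S n ω‖ ≤ M

/-- The reproducing kernel of the Hilbert space `H` of real functions on `X` is `k`. -/
def IsInducedBy {X : Type*} (H : Type*) [NormedAddCommGroup H] [InnerProductSpace ℝ H]
    [CompleteSpace H] [RKHS ℝ H X ℝ] (k : X → X → ℝ) : Prop :=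
  ∀ z w, RKHS.kernel H z w 1 = k z w

/-- The product kernel `(k₁ ⊗ k₂)((x, y), (x', y')) = k₁(x, x') k₂(y, y')`. -/
def prodKernel {X Y : Type*} (k₁ : X → X → ℝ) (k₂ : Y → Y → ℝ) (z w : X × Y) : ℝ :=
  k₁ z.1 w.1 * k₂ z.2 w.2

end CausalVelocity

end

/-! Insert the empirical loss at the true scores: the error is a plug-in error plus a sampling
error. Since `|f x| ≤ √B * ‖f‖` in both RKHSs (`IsInducedBy.abs_apply_le`), and `v` and its
derivative are bounded, the squared residual at the true scores is bounded. Its i.i.d. mean thus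
errs by `n^(-1/2)`, by Chebyshev (`isBigOp_empiricalMean_sub_integral`). For the plug-in error, the
norm bounds confine all scores to one bounded range, where the squared residual is Lipschitz in them
(`abs_sqResidual_sub_le`). RKHS errors dominate sup-norm errors, so this bound is uniform over
points, and the estimators may depend on the sample in any way. The slower of the two rates remains.
-/

open MeasureTheory ProbabilityTheory Filter

namespace CausalVelocity

/-! ### Calculus of `O_p` -/

namespace IsBigOp

variable {Ω : Type*} [MeasurableSpace Ω] {P : Measure Ω} {U V : ℕ → Ω → ℝ} {r r' : ℕ → ℝ}

lemma add (hU : IsBigOp P U r) (hV : IsBigOp P V r) :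
    IsBigOp P (fun n ω => U n ω + V n ω) r := by
  intro ε hε
  obtain ⟨M, hM, hUM⟩ := hU (ε / 2) (half_pos hε)
  obtain ⟨N, hN, hVN⟩ := hV (ε / 2) (half_pos hε)
  refine ⟨M + N, add_pos hM hN, ?_⟩
  filter_upwards [hUM, hVN] with n h₁ h₂
  have hsub : {ω | (M + N) * r n < |U n ω + V n ω|} ⊆
      {ω | M * r n < |U n ω|} ∪ {ω | N * r n < |V n ω|} := by
    intro ω hω
    simp only [Set.mem_ofPred_eq, Set.mem_union] at hω ⊢
    by_contra! h
    linarith [abs_add_le (U n ω) (V n ω), h.1, h.2]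
  calc P {ω | (M + N) * r n < |U n ω + V n ω|}
      ≤ P {ω | M * r n < |U n ω|} + P {ω | N * r n < |V n ω|} :=
        (measure_mono hsub).trans (measure_union_le _ _)
    _ ≤ ENNReal.ofReal (ε / 2) + ENNReal.ofReal (ε / 2) := add_le_add h₁ h₂
    _ = ENNReal.ofReal ε := by
        rw [← ENNReal.ofReal_add (by positivity) (by positivity), add_halves]

lemma mono_rate (hU : IsBigOp P U r) (h : ∀ᶠ n in atTop, r n ≤ r' n) : IsBigOp P U r' := by
  intro ε hε
  obtain ⟨M, hM, hUM⟩ := hU ε hε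
  refine ⟨M, hM, ?_⟩
  filter_upwards [hUM, h] with n h₁ h₂
  exact (measure_mono fun ω hω => (mul_le_mul_of_nonneg_left h₂ hM.le).trans_lt hω).trans h₁

/-- Almost sure domination suffices because null sets do not change outer measure, so the estimators
need no measurability. -/
lemma of_ae_abs_le {C : ℝ} (hC : 0 < C) (hV : IsBigOp P V r)
    (h : ∀ᶠ n in atTop, ∀ᵐ ω ∂P, |U n ω| ≤ C * |V n ω|) : IsBigOp P U r := by
  intro ε hε
  obtain ⟨M, hM, hVM⟩ := hV ε hε
  refine ⟨C * M, mul_pos hC hM, ?_⟩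
  filter_upwards [hVM, h] with n h₁ h₂
  refine (measure_mono_ae ?_).trans h₁
  filter_upwards [h₂] with ω hω hlt
  have hlt : C * M * r n < |U n ω| := hlt
  exact lt_of_mul_lt_mul_left (by linarith : C * (M * r n) < C * |V n ω|) hC.le

end IsBigOp

/-- The empirical mean of a bounded function of an i.i.d. sample converges to its expectation at
the parametric rate. -/
lemma isBigOp_empiricalMean_sub_integral {Ω E : Type*} [MeasurableSpace Ω] [MeasurableSpace E]
    {P : Measure Ω} [IsProbabilityMeasure P] {μ : Measure E} {Z : ℕ → Ω → E}
    (hZ_law : ∀ i, HasLaw (Z i) μ P) (hZ_indep : iIndepFun Z P)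
    {f : E → ℝ} (hf : Measurable f) {R : ℝ} (hfR : ∀ z, |f z| ≤ R) :
    IsBigOp P (fun n ω => (1 / (n : ℝ)) * ∑ i ∈ Finset.range n, f (Z i ω) - ∫ z, f z ∂μ)
      (fun n => (n : ℝ) ^ (-(1 / 2) : ℝ)) := by
  have hmeas : ∀ i, AEMeasurable (fun ω => f (Z i ω)) P := fun i =>
    hf.comp_aemeasurable (hZ_law i).aemeasurable
  have hLp : ∀ i, MemLp (fun ω => f (Z i ω)) 2 P := fun i =>
    MemLp.of_bound (hmeas i).aestronglyMeasurable R (ae_of_all _ fun ω => hfR _)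
  have hmean : ∀ i, ∫ ω, f (Z i ω) ∂P = ∫ z, f z ∂μ := fun i => by
    rw [← (hZ_law i).map_eq, integral_map (hZ_law i).aemeasurable hf.aestronglyMeasurable]
  have hvar : ∀ i, variance (fun ω => f (Z i ω)) P ≤ R ^ 2 := fun i => by
    have := variance_le_sq_of_bounded (μ := P) (a := -R) (b := R)
      (ae_of_all _ fun ω => abs_le.1 (hfR (Z i ω))) (hmeas i)
    simpa using this
  intro ε hε
  -- Chebyshev will give the bound `R² / M²`, so `M² ≥ R² / ε` is wanted; the `+ 1` keeps `M`
  -- positive when `R = 0`.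
  refine ⟨Real.sqrt (R ^ 2 / ε) + 1, by positivity, ?_⟩
  set M := Real.sqrt (R ^ 2 / ε) + 1
  have hM : R ^ 2 / M ^ 2 ≤ ε := by
    have h₁ : R ^ 2 / ε ≤ M ^ 2 := by
      rw [← Real.sq_sqrt (show 0 ≤ R ^ 2 / ε by positivity)]
      exact pow_le_pow_left₀ (Real.sqrt_nonneg _) (by simp [M]) 2
    rw [div_le_iff₀ (by positivity)]
    rwa [div_le_iff₀ hε, mul_comm] at h₁
  filter_upwards [eventually_gt_atTop 0] with n hn
  have hn' : (0 : ℝ) < n := by exact_mod_cast hn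
  have hS : MemLp (∑ i ∈ Finset.range n, fun ω => f (Z i ω)) 2 P :=
    memLp_finsetSum' _ fun i _ => hLp i
  have hA : MemLp (fun ω => (1 / (n : ℝ)) * ∑ i ∈ Finset.range n, f (Z i ω)) 2 P := by
    simpa [Finset.sum_apply] using hS.const_mul (1 / (n : ℝ))
  have hA_mean : ∫ ω, (1 / (n : ℝ)) * ∑ i ∈ Finset.range n, f (Z i ω) ∂P = ∫ z, f z ∂μ := by
    rw [integral_const_mul, integral_finsetSum _ fun i _ => (hLp i).integrable (by norm_num)]
    simp only [hmean, Finset.sum_const, Finset.card_range, nsmul_eq_mul]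
    field_simp
  have hA_var : variance (fun ω => (1 / (n : ℝ)) * ∑ i ∈ Finset.range n, f (Z i ω)) P
      ≤ R ^ 2 / n := by
    have hsum : variance (fun ω => ∑ i ∈ Finset.range n, f (Z i ω)) P ≤ n * R ^ 2 := by
      -- Pairwise independence makes the variance additive, whence `R² / n` for the mean.
      have := IndepFun.variance_sum (μ := P) (s := Finset.range n) (X := fun i ω => f (Z i ω))
        (fun i _ => hLp i) fun i _ j _ hij =>
          (hZ_indep.indepFun hij).comp hf hf
      have heq : (fun ω => ∑ i ∈ Finset.range n, f (Z i ω)) =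
          ∑ i ∈ Finset.range n, fun ω => f (Z i ω) := by ext; simp
      rw [heq, this]
      calc _ ≤ ∑ _i ∈ Finset.range n, R ^ 2 := Finset.sum_le_sum fun i _ => hvar i
        _ = n * R ^ 2 := by simp
    rw [variance_const_mul]
    calc (1 / (n : ℝ)) ^ 2 * variance (fun ω => ∑ i ∈ Finset.range n, f (Z i ω)) P
        ≤ (1 / (n : ℝ)) ^ 2 * (n * R ^ 2) := by gcongr
      _ = R ^ 2 / n := by field_simp
  have hrate : (0 : ℝ) < M * (n : ℝ) ^ (-(1 / 2) : ℝ) := by positivity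
  have hcheb := meas_ge_le_variance_div_sq hA hrate
  rw [hA_mean] at hcheb
  refine (measure_mono (Set.ofPred_subset_ofPred.2 fun ω => le_of_lt)).trans
    (hcheb.trans (ENNReal.ofReal_le_ofReal ?_))
  have hsq : (M * (n : ℝ) ^ (-(1 / 2) : ℝ)) ^ 2 = M ^ 2 / n := by
    rw [mul_pow, ← Real.rpow_natCast ((n : ℝ) ^ _), ← Real.rpow_mul hn'.le]
    norm_num [Real.rpow_neg_one, div_eq_mul_inv]
  rw [hsq]
  calc _ ≤ R ^ 2 / n / (M ^ 2 / n) := by gcongr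
    _ = R ^ 2 / M ^ 2 := by field_simp
    _ ≤ ε := hM

/-- Point evaluation in an RKHS whose kernel is at most `B` on the diagonal is bounded by `√B`. -/
lemma IsInducedBy.abs_apply_le {X H : Type*} [NormedAddCommGroup H] [InnerProductSpace ℝ H]
    [CompleteSpace H] [RKHS ℝ H X ℝ] {k : X → X → ℝ} (hk : IsInducedBy H k) {B : ℝ}
    (hB : ∀ x, k x x ≤ B) (f : H) (x : X) : |f x| ≤ √B * ‖f‖ := by
  have hnorm : ‖RKHS.kerFun H x 1‖ ^ 2 = k x x := by
    rw [← hk x x, ← real_inner_self_eq_norm_sq, RKHS.inner_kerFun, RKHS.kerFun_apply]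
    simp
  have hle : ‖RKHS.kerFun H x 1‖ ≤ √B := Real.le_sqrt_of_sq_le (hnorm.trans_le (hB x))
  have hf : f x = inner ℝ f (RKHS.kerFun H x 1) := by
    rw [RKHS.inner_kerFun]; simp
  rw [hf]
  calc _ ≤ ‖f‖ * ‖RKHS.kerFun H x 1‖ := abs_real_inner_le_norm _ _
    _ ≤ ‖f‖ * √B := by gcongr
    _ = √B * ‖f‖ := mul_comm _ _

/-! ### Measurability of the scores and the residual -/

/-- The slice being differentiated varies with the point; rewriting its derivative as a value of
`fderiv` gives measurability without continuity of the derivative. -/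
lemma deriv_fst_eq_fderiv {g : ℝ × ℝ → ℝ} (hg : Differentiable ℝ g) (x y : ℝ) :
    deriv (fun t => g (t, y)) x = fderiv ℝ g (x, y) (1, 0) :=
  ((hg (x, y)).hasFDerivAt.comp_hasDerivAt x
    ((hasDerivAt_id x).prodMk (hasDerivAt_const x y))).deriv

lemma deriv_snd_eq_fderiv {g : ℝ × ℝ → ℝ} (hg : Differentiable ℝ g) (x y : ℝ) :
    deriv (fun t => g (x, t)) y = fderiv ℝ g (x, y) (0, 1) :=
  ((hg (x, y)).hasFDerivAt.comp_hasDerivAt y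
    ((hasDerivAt_const y x).prodMk (hasDerivAt_id y))).deriv

lemma measurable_marginalScore (pX : ℝ → ℝ) : Measurable (marginalScore pX) :=
  measurable_deriv _

lemma measurable_jointScoreX {p : ℝ × ℝ → ℝ} (hp : Differentiable ℝ fun z => Real.log (p z)) :
    Measurable (jointScoreX p) := by
  have h : jointScoreX p = fun z => fderiv ℝ (fun z => Real.log (p z)) z (1, 0) :=
    funext fun z => deriv_fst_eq_fderiv hp z.1 z.2
  rw [h]
  exact measurable_fderiv_apply_const ℝ _ _

lemma measurable_jointScoreY {p : ℝ × ℝ → ℝ} (hp : Differentiable ℝ fun z => Real.log (p z)) :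
    Measurable (jointScoreY p) := by
  have h : jointScoreY p = fun z => fderiv ℝ (fun z => Real.log (p z)) z (0, 1) :=
    funext fun z => deriv_snd_eq_fderiv hp z.1 z.2
  rw [h]
  exact measurable_fderiv_apply_const ℝ _ _

lemma measurable_sqResidual {v : ℝ × ℝ → ℝ} (hv : Differentiable ℝ v) {a : ℝ → ℝ}
    {b c : ℝ × ℝ → ℝ} (ha : Measurable a) (hb : Measurable b) (hc : Measurable c) :
    Measurable (sqResidual v a b c) := by
  have hswap : Measurable fun z : ℝ × ℝ => (z.2, z.1) := measurable_swap
  have hd : Measurable fun z : ℝ × ℝ => deriv (fun t => v (t, z.1)) z.2 := by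
    simp_rw [deriv_fst_eq_fderiv hv]
    exact (measurable_fderiv_apply_const ℝ v (1, 0)).comp hswap
  have hv' : Measurable fun z : ℝ × ℝ => v (z.2, z.1) := hv.continuous.measurable.comp hswap
  exact (((ha.comp measurable_fst).sub hd).sub (hb.add (hv'.mul hc))).pow_const 2

/-! ### Boundedness and Lipschitz dependence on the scores -/

lemma IsCbOne.exists_bound {v : ℝ × ℝ → ℝ} (hv : IsCbOne v) :
    ∃ A : ℝ, 0 ≤ A ∧ (∀ w, |v w| ≤ A) ∧ ∀ z : ℝ × ℝ, |deriv (fun t => v (t, z.1)) z.2| ≤ A := by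
  obtain ⟨hC, ⟨A₁, h₁⟩, ⟨A₂, h₂⟩⟩ := hv
  refine ⟨max A₁ A₂, (abs_nonneg _).trans ((h₁ 0).trans (le_max_left _ _)),
    fun w => (h₁ w).trans (le_max_left _ _), fun z => le_trans ?_ (le_max_right A₁ A₂)⟩
  rw [deriv_fst_eq_fderiv (hC.differentiable (by norm_num)), ← Real.norm_eq_abs]
  refine (ContinuousLinearMap.le_opNorm _ _).trans ?_
  -- The direction `(1, 0)` has norm one.
  simpa [Prod.norm_def] using h₂ (z.2, z.1)

lemma abs_residual_le {a d b v c A T : ℝ} (hv : |v| ≤ A) (hd : |d| ≤ A)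
    (ha : |a| ≤ T) (hb : |b| ≤ T) (hc : |c| ≤ T) :
    |a - d - (b + v * c)| ≤ A + (2 + A) * T := by
  have hvc : |v * c| ≤ A * T := by
    rw [abs_mul]
    exact mul_le_mul hv hc (abs_nonneg _) ((abs_nonneg _).trans hv)
  calc |a - d - (b + v * c)| ≤ |a| + |d| + (|b| + |v * c|) :=
        (abs_sub _ _).trans (add_le_add (abs_sub _ _) (abs_add_le _ _))
    _ ≤ A + (2 + A) * T := by linarith

lemma abs_sqResidual_le {v : ℝ × ℝ → ℝ} {a : ℝ → ℝ} {b c : ℝ × ℝ → ℝ} {A T : ℝ} {z : ℝ × ℝ}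
    (hv : |v (z.2, z.1)| ≤ A) (hd : |deriv (fun t => v (t, z.1)) z.2| ≤ A)
    (ha : |a z.1| ≤ T) (hb : |b z| ≤ T) (hc : |c z| ≤ T) :
    |sqResidual v a b c z| ≤ (A + (2 + A) * T) ^ 2 := by
  rw [sqResidual, abs_pow]
  exact pow_le_pow_left₀ (abs_nonneg _) (abs_residual_le hv hd ha hb hc) 2

/-- The squared residual is Lipschitz in the scores, on bounded sets of scores. -/
lemma abs_sqResidual_sub_le {v : ℝ × ℝ → ℝ} {a a' : ℝ → ℝ} {b b' c c' : ℝ × ℝ → ℝ}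
    {A T δ₁ δ₂ δ₃ : ℝ} {z : ℝ × ℝ}
    (hv : |v (z.2, z.1)| ≤ A) (hd : |deriv (fun t => v (t, z.1)) z.2| ≤ A)
    (ha : |a z.1| ≤ T) (hb : |b z| ≤ T) (hc : |c z| ≤ T)
    (ha' : |a' z.1| ≤ T) (hb' : |b' z| ≤ T) (hc' : |c' z| ≤ T)
    (h₁ : |a z.1 - a' z.1| ≤ δ₁) (h₂ : |b z - b' z| ≤ δ₂) (h₃ : |c z - c' z| ≤ δ₃) :
    |sqResidual v a b c z - sqResidual v a' b' c' z|
      ≤ 2 * (A + (2 + A) * T) * ((1 + A) * (δ₁ + δ₂ + δ₃)) := by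
  have hA : 0 ≤ A := (abs_nonneg _).trans hv
  have hδ₁ := (abs_nonneg _).trans h₁
  have hδ₂ := (abs_nonneg _).trans h₂
  have hδ₃ := (abs_nonneg _).trans h₃
  set d := deriv (fun t => v (t, z.1)) z.2
  set x := a z.1 - d - (b z + v (z.2, z.1) * c z) with hx
  set y := a' z.1 - d - (b' z + v (z.2, z.1) * c' z) with hy
  have hxR : |x| ≤ A + (2 + A) * T := abs_residual_le hv hd ha hb hc
  have hyR : |y| ≤ A + (2 + A) * T := abs_residual_le hv hd ha' hb' hc'
  have hsum : |x + y| ≤ 2 * (A + (2 + A) * T) := (abs_add_le x y).trans (by linarith)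
  have hdiff : |x - y| ≤ (1 + A) * (δ₁ + δ₂ + δ₃) := by
    have heq : x - y =
        (a z.1 - a' z.1) - ((b z - b' z) + v (z.2, z.1) * (c z - c' z)) := by
      rw [hx, hy]; ring
    have hvc : |v (z.2, z.1) * (c z - c' z)| ≤ A * δ₃ := by
      rw [abs_mul]
      exact mul_le_mul hv h₃ (abs_nonneg _) hA
    calc |x - y| ≤ |a z.1 - a' z.1| + (|b z - b' z| + |v (z.2, z.1) * (c z - c' z)|) := by
          rw [heq]
          exact (abs_sub _ _).trans (add_le_add le_rfl (abs_add_le _ _))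
      _ ≤ δ₁ + (δ₂ + A * δ₃) := add_le_add h₁ (add_le_add h₂ hvc)
      _ ≤ (1 + A) * (δ₁ + δ₂ + δ₃) := by
          linarith [mul_nonneg hA hδ₁, mul_nonneg hA hδ₂]
  -- Factor the difference of squares: boundedness controls `x + y`, and the score errors enter only
  -- through `x - y`.
  calc |sqResidual v a b c z - sqResidual v a' b' c' z| = |x + y| * |x - y| := by
        rw [← abs_mul, ← sq_sub_sq]; rfl
    _ ≤ _ := mul_le_mul hsum hdiff (abs_nonneg _) ((abs_nonneg _).trans hsum)

lemma abs_empiricalGof_sub_le {v : ℝ × ℝ → ℝ} {a a' : ℝ → ℝ} {b b' c c' : ℝ × ℝ → ℝ} {δ : ℝ}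
    (h : ∀ z, |sqResidual v a b c z - sqResidual v a' b' c' z| ≤ δ) (n : ℕ) (z : ℕ → ℝ × ℝ) :
    |empiricalGof n z v a b c - empiricalGof n z v a' b' c'| ≤ δ := by
  have hδ : 0 ≤ δ := (abs_nonneg _).trans (h 0)
  rw [empiricalGof, empiricalGof, ← mul_sub, ← Finset.sum_sub_distrib, abs_mul,
    abs_of_nonneg (by positivity : 0 ≤ 1 / (n : ℝ))]
  calc 1 / (n : ℝ) * |∑ i ∈ Finset.range n,
        (sqResidual v a b c (z i) - sqResidual v a' b' c' (z i))|
      ≤ 1 / (n : ℝ) * ∑ _i ∈ Finset.range n, δ := by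
        gcongr
        exact (Finset.abs_sum_le_sum_abs _ _).trans (Finset.sum_le_sum fun i _ => h (z i))
    _ = (1 / (n : ℝ) * n) * δ := by simp [mul_assoc]
    -- An inequality, since `1 / n * n` is `0` at `n = 0`.
    _ ≤ 1 * δ := by
        gcongr
        rw [one_div]
        exact inv_mul_le_one
    _ = δ := one_mul δ

lemma eventually_rpow_neg_one_div_le {α β : ℝ} (hα : 0 < α) (h : α ≤ β) :
    ∀ᶠ n : ℕ in atTop, (n : ℝ) ^ (-(1 / α)) ≤ (n : ℝ) ^ (-(1 / β)) := by
  filter_upwards [eventually_ge_atTop 1] with n hn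
  exact Real.rpow_le_rpow_of_exponent_le (by exact_mod_cast hn)
    (neg_le_neg (one_div_le_one_div_of_le hα h))

end CausalVelocity

theorem theorem3
    -- the data: an i.i.d. sequence with law `μ = P_{X,Y}`, with regular joint and marginal densities
    {Ω : Type*} [MeasurableSpace Ω] (P : Measure Ω) [IsProbabilityMeasure P]
    (μ : Measure (ℝ × ℝ)) [IsProbabilityMeasure μ]
    (p : ℝ × ℝ → ℝ) (pX : ℝ → ℝ)
    (hp : CausalVelocity.HasPosDiffDensity μ p)
    (hpX : CausalVelocity.HasPosDiffDensity (μ.map Prod.fst) pX)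
    (Z : ℕ → Ω → ℝ × ℝ) (hZ_law : ∀ i, HasLaw (Z i) μ P) (hZ_indep : iIndepFun Z P)
    -- the RKHSs, induced by the bounded kernels `kX` and `kX ⊗ kY`
    (kX kY : ℝ → ℝ → ℝ)
    (hkX : (Matrix.of kX).PosSemidef) (hkY : (Matrix.of kY).PosSemidef)
    (B : ℝ) (hkX_lt : ∀ x x', kX x x' < B)
    (hkXY_lt : ∀ z z', CausalVelocity.prodKernel kX kY z z' < B)
    {HX : Type*} [NormedAddCommGroup HX] [InnerProductSpace ℝ HX] [CompleteSpace HX]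
    [RKHS ℝ HX ℝ ℝ] (hHX : CausalVelocity.IsInducedBy HX kX)
    {HXY : Type*} [NormedAddCommGroup HXY] [InnerProductSpace ℝ HXY] [CompleteSpace HXY]
    [RKHS ℝ HXY (ℝ × ℝ) ℝ]
    (hHXY : CausalVelocity.IsInducedBy HXY (CausalVelocity.prodKernel kX kY))
    -- the true scores, as elements of the RKHSs
    (s : HX) (hs : ∀ x, s x = CausalVelocity.marginalScore pX x)
    (sx sy : HXY) (hsx : ∀ z, sx z = CausalVelocity.jointScoreX p z)
    (hsy : ∀ z, sy z = CausalVelocity.jointScoreY p z)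
    -- the velocity
    (v : ℝ × ℝ → ℝ) (hv : CausalVelocity.IsCbOne v)
    -- the score estimators: arbitrary random elements, such as functions of `Z 0, …, Z (n - 1)`
    (sHat : ℕ → Ω → HX) (sxHat syHat : ℕ → Ω → HXY)
    (hsHat_bdd : CausalVelocity.IsNormBounded P sHat)
    (hsxHat_bdd : CausalVelocity.IsNormBounded P sxHat)
    (hsyHat_bdd : CausalVelocity.IsNormBounded P syHat)
    (α : ℝ) (hα : 0 < α)
    (hsHat : CausalVelocity.IsBigOp P (fun n ω => ‖sHat n ω - s‖)
      (fun n => (n : ℝ) ^ (-(1 / α))))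
    (hsxHat : CausalVelocity.IsBigOp P (fun n ω => ‖sxHat n ω - sx‖)
      (fun n => (n : ℝ) ^ (-(1 / α))))
    (hsyHat : CausalVelocity.IsBigOp P (fun n ω => ‖syHat n ω - sy‖)
      (fun n => (n : ℝ) ^ (-(1 / α)))) :
    Integrable (CausalVelocity.sqResidual v (CausalVelocity.marginalScore pX)
        (CausalVelocity.jointScoreX p) (CausalVelocity.jointScoreY p)) μ ∧
    CausalVelocity.IsBigOp P
      (fun n ω => CausalVelocity.empiricalGof n (fun i => Z i ω) v
          (sHat n ω) (sxHat n ω) (syHat n ω)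
        - CausalVelocity.gof μ p pX v)
      (fun n => (n : ℝ) ^ (-(1 / max α 2))) := by
  obtain ⟨A, hA, hvA, hdA⟩ := hv.exists_bound
  have hv_diff : Differentiable ℝ v := hv.1.differentiable (by norm_num)
  have hevX := hHX.abs_apply_le fun x => (hkX_lt x x).le
  have hevXY := hHXY.abs_apply_le fun z => (hkXY_lt z z).le
  have hs' : ⇑s = CausalVelocity.marginalScore pX := funext hs
  have hsx' : ⇑sx = CausalVelocity.jointScoreX p := funext hsx
  have hsy' : ⇑sy = CausalVelocity.jointScoreY p := funext hsy
  have hgof : CausalVelocity.gof μ p pX v = ∫ z, CausalVelocity.sqResidual v s sx sy z ∂μ := by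
    rw [CausalVelocity.gof, hs', hsx', hsy']
  have hmeas : Measurable (CausalVelocity.sqResidual v s sx sy) := by
    rw [hs', hsx', hsy']
    exact CausalVelocity.measurable_sqResidual hv_diff
      (CausalVelocity.measurable_marginalScore pX)
      (CausalVelocity.measurable_jointScoreX hp.differentiable_log)
      (CausalVelocity.measurable_jointScoreY hp.differentiable_log)
  obtain ⟨M₁, hM₁⟩ := hsHat_bdd
  obtain ⟨M₂, hM₂⟩ := hsxHat_bdd
  obtain ⟨M₃, hM₃⟩ := hsyHat_bdd
  -- One radius for true and estimated scores, so that a single Lipschitz constant serves for all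
  -- large `n`.
  obtain ⟨M, hM⟩ : ∃ M, ∀ x ∈ ({M₁, M₂, M₃, ‖s‖, ‖sx‖, ‖sy‖} : Set ℝ), x ≤ M :=
    (Set.toFinite _).bddAbove
  simp only [Set.mem_insert_iff, Set.mem_singleton_iff, forall_eq_or_imp, forall_eq] at hM
  obtain ⟨hMM₁, hMM₂, hMM₃, hMs, hMsx, hMsy⟩ := hM
  have boundX : ∀ f : HX, ‖f‖ ≤ M → ∀ x, |f x| ≤ √B * M := fun f hf x =>
    (hevX f x).trans (mul_le_mul_of_nonneg_left hf (Real.sqrt_nonneg B))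
  have boundXY : ∀ f : HXY, ‖f‖ ≤ M → ∀ z, |f z| ≤ √B * M := fun f hf z =>
    (hevXY f z).trans (mul_le_mul_of_nonneg_left hf (Real.sqrt_nonneg B))
  have hbound : ∀ z, |CausalVelocity.sqResidual v s sx sy z|
      ≤ (A + (2 + A) * (√B * M)) ^ 2 := fun z =>
    CausalVelocity.abs_sqResidual_le (hvA _) (hdA z) (boundX s hMs _) (boundXY sx hMsx z)
      (boundXY sy hMsy z)
  refine ⟨?_, ?_⟩
  · rw [← hs', ← hsx', ← hsy']
    exact Integrable.of_bound hmeas.aestronglyMeasurable _ (ae_of_all _ hbound)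
  have hsample := (CausalVelocity.isBigOp_empiricalMean_sub_integral hZ_law hZ_indep hmeas
    hbound).mono_rate (CausalVelocity.eventually_rpow_neg_one_div_le two_pos (le_max_right α 2))
  have hscores := ((hsHat.add hsxHat).add hsyHat).mono_rate
    (CausalVelocity.eventually_rpow_neg_one_div_le hα (le_max_left α 2))
  have hM0 : 0 ≤ M := (norm_nonneg s).trans hMs
  have hplug : CausalVelocity.IsBigOp P
      (fun n ω => CausalVelocity.empiricalGof n (fun i => Z i ω) v
          (sHat n ω) (sxHat n ω) (syHat n ω)
        - CausalVelocity.empiricalGof n (fun i => Z i ω) v s sx sy)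
      (fun n => (n : ℝ) ^ (-(1 / max α 2))) := by
    refine CausalVelocity.IsBigOp.of_ae_abs_le
      -- The Lipschitz constant times the `√B` of point evaluation; the `+ 1` makes it positive even
      -- if `A = M = 0`.
      (C := 2 * (A + (2 + A) * (√B * M)) * ((1 + A) * √B) + 1) (by positivity) hscores ?_
    filter_upwards [hM₁, hM₂, hM₃] with n h₁ h₂ h₃
    filter_upwards [h₁, h₂, h₃] with ω h₁ h₂ h₃
    have hδ : 0 ≤ ‖sHat n ω - s‖ + ‖sxHat n ω - sx‖ + ‖syHat n ω - sy‖ := by positivity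
    rw [abs_of_nonneg hδ]
    refine (CausalVelocity.abs_empiricalGof_sub_le (fun z =>
      CausalVelocity.abs_sqResidual_sub_le (hvA _) (hdA z)
        (boundX _ (h₁.trans hMM₁) _) (boundXY _ (h₂.trans hMM₂) z) (boundXY _ (h₃.trans hMM₃) z)
        (boundX s hMs _) (boundXY sx hMsx z) (boundXY sy hMsy z)
        (by simpa using hevX (sHat n ω - s) z.1) (by simpa using hevXY (sxHat n ω - sx) z)
        (by simpa using hevXY (syHat n ω - sy) z))
      n _).trans ?_
    linarith
  convert hplug.add hsample using 3 with n ω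
  rw [hgof, CausalVelocity.empiricalGof, CausalVelocity.empiricalGof]
  ring
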